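/- \textbf{Proposition (Tree recursion).} Let $0\le\beta<\infty$ and $B>0$. Let $\rho$ be a probability distribution on $\{0,1,2,\dots\}\cup\{\infty\}$ and let $(K_t)_{t\ge 0}$ be i.i.d. with distribution $\rho$ and almost surely finite. Let $(h^{(t)})_{t\ge0}$ be real random variables with $h^{(0)}\equiv B$ and, for every $t\ge 0$, $$h^{(t+1)}\;\stackrel{d}{=}\;B+\sum_{i=1}^{K_t}\operatorname{artanh}\bigl(\tanh(\beta)\tanh(h^{(t)}_i)\bigr),\qquad(\ast)$$ where $(h^{(t)}_i)_{i\ge1}$ are i.i.d. copies of $h^{(t)}$, independent of $K_t$. Then: (1) The laws of $h^{(t)}$ are stochastically increasing in $t$: $\mathbb P(h^{(s)}>x)\le\mathbb P(h^{(t)}>x)$ for all $x\in\mathbb R$ and all $0\le s\le t$. (2) The recursion has exactly one fixed point supported on $[0,\infty)$. That is, there is exactly one probability measure $\nu^*$ on $\mathbb R$ with $\nu^*([0,\infty))=1$ such that, if $h_1,h_2,\dots$ are i.i.d. with law $\nu^*$ and $K$ is independent of them with law $\rho$, then $B+\sum_{i=1}^{K}\operatorname{artanh}(\tanh(\beta)\tanh(h_i))$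 again has law $\nu^*$. (3) $h^{(t)}$ converges in distribution, as $t\to\infty$, to a random variable $h^*$ with law $\nu^*$. -/

import Mathlib

open MeasureTheory ProbabilityTheory Filter

/-- The value of one step of the recursion: `B + ∑_{i < k} artanh (tanh β * tanh x_i)`.
It is used only for `k < ⊤`. -/
noncomputable def recursionStep (β B : ℝ) (k : ℕ∞) (x : ℕ → ℝ) : ℝ :=
  B + ∑ i ∈ Finset.range k.toNat, Real.artanh (Real.tanh β * Real.tanh (x i))

theorem measurable_recursionStep (β B : ℝ) :
    Measurable (fun p : ℕ∞ × (ℕ → ℝ) => recursionStep β B p.1 p.2) := by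
  have hart : Measurable Real.artanh := by
    unfold Real.artanh
    fun_prop
  have htanh : Measurable Real.tanh := by
    have : Real.tanh = fun x => Real.sinh x / Real.cosh x := by
      funext x
      exact Real.tanh_eq_sinh_div_cosh x
    rw [this]
    fun_prop
  refine measurable_from_prod_countable_right fun k => ?_
  unfold recursionStep
  have hsum : Measurable (fun x : ℕ → ℝ =>
      ∑ i ∈ Finset.range k.toNat, Real.artanh (Real.tanh β * Real.tanh (x i))) := by
    refine Finset.measurable_sum _ fun i _ => ?_
    exact hart.comp (measurable_const.mul (htanh.comp (measurable_pi_apply i)))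
  exact measurable_const.add hsum

/-- The law of `B + ∑_{i < K} artanh (tanh β * tanh x_i)`, where `K` has law `ρ`, the `x_i` are
i.i.d. with law `ν`, and `K` is independent of `(x_i)`. -/
noncomputable def recursionLaw (β B : ℝ) (ρ : Measure ℕ∞) (ν : Measure ℝ)
    [IsProbabilityMeasure ν] : Measure ℝ :=
  (ρ.prod (Measure.infinitePi fun _ : ℕ => ν)).map fun p => recursionStep β B p.1 p.2

/-- `recursionLaw` is the law of the random sum, for any choice of the random variables. -/
theorem map_recursionStep_eq {Ω : Type*} [MeasurableSpace Ω] {P : Measure Ω}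
    [IsProbabilityMeasure P] (β B : ℝ) {ρ : Measure ℕ∞} {ν : Measure ℝ} [IsProbabilityMeasure ν]
    {K : Ω → ℕ∞} {X : ℕ → Ω → ℝ} (hK : HasLaw K ρ P) (hX : ∀ i, HasLaw (X i) ν P)
    (hXi : iIndepFun X P) (hKX : IndepFun K (fun ω i => X i ω) P) :
    P.map (fun ω => recursionStep β B (K ω) (fun i => X i ω)) = recursionLaw β B ρ ν := by
  have hXm : AEMeasurable (fun ω i => X i ω) P := aemeasurable_pi_iff.2 fun i => (hX i).aemeasurable
  have h1 := (indepFun_iff_map_prod_eq_prod_map_map hK.aemeasurable hXm).1 hKX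
  have h2 := (iIndepFun_iff_map_fun_eq_infinitePi_map₀ hXm).1 hXi
  have h3 : (Measure.infinitePi fun i => P.map (X i)) = Measure.infinitePi fun _ : ℕ => ν := by
    congr 1
    funext i
    exact (hX i).map_eq
  rw [h2, h3, hK.map_eq] at h1
  rw [recursionLaw, ← h1, AEMeasurable.map_map_of_aemeasurable
    (measurable_recursionStep β B).aemeasurable (hK.aemeasurable.prodMk hXm)]
  rfl

/-- `ν` is a fixed point, supported on `[0, ∞)`, of the distributional recursion. -/
def IsNonnegFixedPoint (β B : ℝ) (ρ : Measure ℕ∞) (ν : ProbabilityMeasure ℝ) : Prop :=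
  recursionLaw β B ρ (ν : Measure ℝ) = (ν : Measure ℝ) ∧ (ν : Measure ℝ) (Set.Iio 0) = 0

/-- The usual stochastic order: `μ` is stochastically dominated by `ν`. -/
def StochLE (μ ν : Measure ℝ) : Prop :=
  ∀ x : ℝ, μ (Set.Ioi x) ≤ ν (Set.Ioi x)

/-! All the laws are realised on one infinite tree with i.i.d. labels, where the recursion becomes a
pointwise statement. With boundary field `B`, the root field at depth `t` increases in `t` (part 1)
and is bounded given the root label, so it converges; its limit solves the recursion pointwise, and
its law is a fixed point. For uniqueness, any nonnegative boundary field is sandwiched: the lower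
bound is monotonicity. For the upper bound, concavity of `message β` on `[0, ∞)` carries the
comparison `c - a ≤ M * (b - a)` from the leaves to the root with the same `M` (`treeField_sub_le`).
The right side is `M` times an increment of a convergent sequence, so the boundary is forgotten. A
fixed point used as boundary law keeps its law, hence is the law of the limit. -/

open scoped Topology

/-! ### The message function: monotone, bounded, concave -/

/-- The message `artanh (tanh β * tanh x)` that a vertex with field `x` sends to its parent. -/
noncomputable def message (β x : ℝ) : ℝ := Real.artanh (Real.tanh β * Real.tanh x)

theorem tanh_mul_tanh_mem_Ioo (β x : ℝ) :
    Real.tanh β * Real.tanh x ∈ Set.Ioo (-1 : ℝ) 1 := by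
  have h1 : |Real.tanh β| < 1 := Real.abs_tanh_lt_one β
  have h2 : |Real.tanh x| < 1 := Real.abs_tanh_lt_one x
  rw [Set.mem_Ioo, ← abs_lt, abs_mul]
  exact mul_lt_one_of_nonneg_of_lt_one_left (abs_nonneg _) h1 h2.le

theorem tanh_nonneg_of_nonneg {x : ℝ} (hx : 0 ≤ x) : 0 ≤ Real.tanh x := by
  rw [Real.tanh_eq_sinh_div_cosh]
  exact div_nonneg (Real.sinh_nonneg_iff.2 hx) (Real.cosh_pos x).le

theorem hasDerivAt_tanh (x : ℝ) : HasDerivAt Real.tanh (1 / Real.cosh x ^ 2) x := by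
  have h := (Real.hasDerivAt_sinh x).div (Real.hasDerivAt_cosh x) (Real.cosh_pos x).ne'
  have e : Real.tanh = Real.sinh / Real.cosh := by
    funext y
    exact Real.tanh_eq_sinh_div_cosh y
  rw [e]
  refine h.congr_deriv ?_
  congr 1
  linarith [Real.cosh_sq x]

theorem hasDerivAt_artanh {y : ℝ} (hy : y ∈ Set.Ioo (-1 : ℝ) 1) :
    HasDerivAt Real.artanh (1 / (1 - y ^ 2)) y := by
  have h1 : 0 < 1 + y := by linarith [hy.1]
  have h2 : 0 < 1 - y := by linarith [hy.2]
  have h : HasDerivAt (fun z : ℝ => 1 / 2 * (Real.log (1 + z) - Real.log (1 - z)))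
      (1 / 2 * (1 / (1 + y) - (-1) / (1 - y))) y :=
    ((((hasDerivAt_id y).const_add 1).log h1.ne').sub
      (((hasDerivAt_id y).const_sub 1).log h2.ne')).const_mul _
  have e : (fun z : ℝ => 1 / 2 * (Real.log (1 + z) - Real.log (1 - z))) =ᶠ[𝓝 y] Real.artanh := by
    filter_upwards [isOpen_Ioo.mem_nhds hy] with z hz
    rw [Real.artanh_eq_half_log ⟨hz.1.le, hz.2.le⟩, Real.log_div]
    · linarith [hz.1]
    · linarith [hz.2]
  refine (h.congr_of_eventuallyEq e.symm).congr_deriv ?_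
  have h3 : 1 - y ^ 2 ≠ 0 := by nlinarith
  field_simp
  ring

/-- In this form the sign of the derivative and its decrease on `[0, ∞)` can be read off from
`Real.sinh x ^ 2`. -/
theorem hasDerivAt_message (β x : ℝ) :
    HasDerivAt (message β)
      (Real.tanh β / (1 + (1 - Real.tanh β ^ 2) * Real.sinh x ^ 2)) x := by
  have h := (hasDerivAt_artanh (tanh_mul_tanh_mem_Ioo β x)).comp x
    ((hasDerivAt_tanh x).const_mul (Real.tanh β))
  refine h.congr_deriv ?_
  have hc := Real.cosh_pos x
  have key : (1 - (Real.tanh β * Real.tanh x) ^ 2) * Real.cosh x ^ 2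
      = 1 + (1 - Real.tanh β ^ 2) * Real.sinh x ^ 2 := by
    rw [Real.tanh_eq_sinh_div_cosh x]
    field_simp
    rw [Real.cosh_sq x]
    ring
  rw [one_div_mul_eq_div, ← key, mul_one_div, div_div, mul_comm (Real.cosh x ^ 2)]

theorem continuous_message (β : ℝ) : Continuous (message β) :=
  continuous_iff_continuousAt.2 fun x => (hasDerivAt_message β x).continuousAt

theorem message_zero (β : ℝ) : message β 0 = 0 := by
  simp [message]

theorem monotone_message {β : ℝ} (hβ : 0 ≤ β) : Monotone (message β) := by
  refine monotone_of_hasDerivAt_nonneg (hasDerivAt_message β) fun x => ?_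
  refine div_nonneg (tanh_nonneg_of_nonneg hβ) ?_
  have := mul_nonneg (sub_nonneg.2 (Real.tanh_sq_lt_one β).le) (sq_nonneg (Real.sinh x))
  linarith

theorem message_nonneg {β x : ℝ} (hβ : 0 ≤ β) (hx : 0 ≤ x) : 0 ≤ message β x :=
  message_zero β ▸ monotone_message hβ hx

theorem message_le {β : ℝ} (hβ : 0 ≤ β) (x : ℝ) : message β x ≤ β := by
  calc message β x ≤ Real.artanh (Real.tanh β) :=
        Real.artanh_le_artanh (tanh_mul_tanh_mem_Ioo β x).1 (Real.tanh_lt_one β)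
          (mul_le_of_le_one_right (tanh_nonneg_of_nonneg hβ) (Real.tanh_lt_one x).le)
    _ = β := Real.artanh_tanh β

theorem message_pos {β x : ℝ} (hβ : 0 < β) (hx : 0 < x) : 0 < message β x := by
  have h : ∀ {y : ℝ}, 0 < y → 0 < Real.tanh y := fun {y} hy => by
    rw [Real.tanh_eq_sinh_div_cosh]
    exact div_pos (Real.sinh_pos_iff.2 hy) (Real.cosh_pos y)
  exact Real.artanh_pos ⟨mul_pos (h hβ) (h hx), (tanh_mul_tanh_mem_Ioo β x).2⟩

theorem concaveOn_message {β : ℝ} (hβ : 0 ≤ β) : ConcaveOn ℝ (Set.Ici 0) (message β) := by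
  refine AntitoneOn.concaveOn_of_deriv (convex_Ici 0) (continuous_message β).continuousOn
    (fun x _ => (hasDerivAt_message β x).differentiableAt.differentiableWithinAt) ?_
  rw [interior_Ici]
  intro x hx y hy hxy
  rw [(hasDerivAt_message β x).deriv, (hasDerivAt_message β y).deriv]
  have h1 := sub_nonneg.2 (Real.tanh_sq_lt_one β).le
  have h2 : Real.sinh x ^ 2 ≤ Real.sinh y ^ 2 :=
    pow_le_pow_left₀ (Real.sinh_nonneg_iff.2 (le_of_lt hx)) (Real.sinh_le_sinh.2 hxy) 2
  have h3 := mul_nonneg h1 (sq_nonneg (Real.sinh x))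
  exact div_le_div_of_nonneg_left (tanh_nonneg_of_nonneg hβ) (by linarith)
    (by linarith [mul_le_mul_of_nonneg_left h2 h1])

/-- If `c - a ≤ M * (b - a)` with `0 ≤ a ≤ b ≤ c`, concavity transports this to the messages. -/
theorem message_sub_le {β M a b c : ℝ} (hβ : 0 ≤ β) (hM : 1 ≤ M) (ha : 0 ≤ a) (hab : a ≤ b)
    (hbc : b ≤ c) (h : c - a ≤ M * (b - a)) :
    message β c - message β a ≤ M * (message β b - message β a) := by
  have hM0 : 0 < M := by linarith
  -- The hypothesis says that `b` lies above the convex combination of `a` and `c` with weight `M⁻¹`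
  -- on `c`.
  have hle : (1 - M⁻¹) * a + M⁻¹ * c ≤ b := by
    have : M⁻¹ * (c - a) ≤ b - a := by rwa [inv_mul_le_iff₀ hM0]
    linarith
  have hconc := (concaveOn_message hβ).2 (Set.mem_Ici.2 ha)
    (Set.mem_Ici.2 (ha.trans (hab.trans hbc)))
    (sub_nonneg.2 (inv_le_one_of_one_le₀ hM)) (inv_nonneg.2 hM0.le) (by ring)
  simp only [smul_eq_mul] at hconc
  have h2 := hconc.trans (monotone_message hβ hle)
  have h3 := mul_le_mul_of_nonneg_left h2 hM0.le
  have h4 : M * ((1 - M⁻¹) * message β a + M⁻¹ * message β c)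
      = M * message β a - message β a + message β c := by
    field_simp
  linarith

/-- A constant comparing the largest possible message with the message of the field `B`. -/
theorem exists_le_mul_message {β B : ℝ} (hβ : 0 ≤ β) (hB : 0 < B) :
    ∃ M : ℝ, 1 ≤ M ∧ β ≤ M * message β B := by
  rcases hβ.eq_or_lt with rfl | hβ'
  · exact ⟨1, le_rfl, by rw [one_mul]; exact message_nonneg le_rfl hB.le⟩
  · have hp := message_pos hβ' hB
    exact ⟨β / message β B, (one_le_div hp).2 (message_le hβ B), (div_mul_cancel₀ _ hp.ne').ge⟩

/-! ### One step of the recursion, for fixed arguments -/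

theorem recursionStep_eq (β B : ℝ) (k : ℕ∞) (x : ℕ → ℝ) :
    recursionStep β B k x = B + ∑ i ∈ Finset.range k.toNat, message β (x i) := rfl

theorem recursionStep_mono {β : ℝ} (B : ℝ) (hβ : 0 ≤ β) (k : ℕ∞) {x y : ℕ → ℝ} (h : x ≤ y) :
    recursionStep β B k x ≤ recursionStep β B k y := by
  simp only [recursionStep_eq]
  gcongr with i
  exact monotone_message hβ (h i)

theorem le_recursionStep {β : ℝ} (B : ℝ) (hβ : 0 ≤ β) (k : ℕ∞) {x : ℕ → ℝ} (h : ∀ i, 0 ≤ x i) :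
    B ≤ recursionStep β B k x :=
  le_add_of_nonneg_right (Finset.sum_nonneg fun i _ => message_nonneg hβ (h i))

theorem recursionStep_le {β : ℝ} (B : ℝ) (hβ : 0 ≤ β) (k : ℕ∞) (x : ℕ → ℝ) :
    recursionStep β B k x ≤ B + k.toNat * β := by
  rw [recursionStep_eq]
  gcongr
  simpa using Finset.sum_le_card_nsmul (Finset.range k.toNat) _ β fun i _ => message_le hβ (x i)

theorem recursionStep_sub_le {β M : ℝ} (B : ℝ) (hβ : 0 ≤ β) (hM : 1 ≤ M) (k : ℕ∞)
    {a b c : ℕ → ℝ} (ha : ∀ i, 0 ≤ a i) (hab : a ≤ b) (hbc : b ≤ c)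
    (h : ∀ i, c i - a i ≤ M * (b i - a i)) :
    recursionStep β B k c - recursionStep β B k a
      ≤ M * (recursionStep β B k b - recursionStep β B k a) := by
  simp only [recursionStep_eq, add_sub_add_left_eq_sub, ← Finset.sum_sub_distrib, Finset.mul_sum]
  exact Finset.sum_le_sum fun i _ => message_sub_le hβ hM (ha i) (hab i) (hbc i) (h i)

theorem tendsto_recursionStep (β B : ℝ) (k : ℕ∞) {x : ℕ → ℕ → ℝ} {y : ℕ → ℝ}
    (h : ∀ i, Tendsto (fun t => x t i) atTop (𝓝 (y i))) :
    Tendsto (fun t => recursionStep β B k (x t)) atTop (𝓝 (recursionStep β B k y)) :=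
  (tendsto_finsetSum _ fun i _ => ((continuous_message β).tendsto _).comp (h i)).const_add B

/-! ### Independence in the labelled tree -/

/-- The law of i.i.d. labels with law `τ`, indexed by the vertices of the infinite tree. -/
noncomputable def treeMeasure {L : Type*} [MeasurableSpace L] (τ : Measure L)
    [IsProbabilityMeasure τ] : Measure (List ℕ → L) :=
  Measure.infinitePi fun _ : List ℕ => τ

/-- The labelling of the subtree rooted at the `i`-th child of the root. -/
def subtree {L : Type*} (i : ℕ) (ω : List ℕ → L) : List ℕ → L := fun v => ω (i :: v)

section Tree

variable {L : Type*} [MeasurableSpace L] (τ : Measure L) [IsProbabilityMeasure τ]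

instance : IsProbabilityMeasure (treeMeasure τ) := by
  unfold treeMeasure
  infer_instance

theorem measurable_subtree (i : ℕ) : Measurable (subtree (L := L) i) :=
  measurable_pi_lambda _ fun _ => measurable_pi_apply _

theorem hasLaw_root : HasLaw (fun ω : List ℕ → L => ω []) τ (treeMeasure τ) :=
  ⟨(measurable_pi_apply _).aemeasurable, Measure.infinitePi_map_eval _ _⟩

theorem hasLaw_subtree (i : ℕ) : HasLaw (subtree (L := L) i) (treeMeasure τ) (treeMeasure τ) :=
  ⟨(measurable_subtree i).aemeasurable,
    Measure.map_infinitePi_infinitePi_of_inj (P := fun _ : List ℕ => τ) (f := fun v => i :: v)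
      fun _ _ h => (List.cons.inj h).2⟩

/-- The map `(i, v) ↦ i :: v` is injective, so the labels below the root form a product over `ℕ ×
List ℕ`; currying groups them by child. -/
theorem iIndepFun_subtree : iIndepFun (fun i => subtree (L := L) i) (treeMeasure τ) := by
  rw [iIndepFun_iff_map_fun_eq_infinitePi_map measurable_subtree]
  have h1 : (treeMeasure τ).map (fun ω (p : ℕ × List ℕ) => ω (p.1 :: p.2))
      = Measure.infinitePi fun _ : ℕ × List ℕ => τ :=
    Measure.map_infinitePi_infinitePi_of_inj (P := fun _ : List ℕ => τ)
      (f := fun p : ℕ × List ℕ => p.1 :: p.2)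
      fun _ _ h => Prod.ext (List.cons.inj h).1 (List.cons.inj h).2
  have h2 := Measure.infinitePi_map_curry (fun (_ : ℕ) (_ : List ℕ) => τ)
  have hm : Measurable fun (ω : List ℕ → L) (p : ℕ × List ℕ) => ω (p.1 :: p.2) :=
    measurable_pi_lambda _ fun _ => measurable_pi_apply _
  rw [← h1, Measure.map_map (MeasurableEquiv.measurable _) hm] at h2
  simp_rw [(hasLaw_subtree τ _).map_eq]
  exact h2

/-- The two sides depend on the disjoint coordinate sets `{[]}` and `{[]}ᶜ`. -/
theorem indepFun_root_subtree :
    IndepFun (fun ω : List ℕ → L => ω []) (fun ω i => subtree i ω) (treeMeasure τ) := by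
  have hind : iIndepFun (fun (v : List ℕ) (ω : List ℕ → L) => ω v) (treeMeasure τ) :=
    iIndepFun_infinitePi (X := fun _ ω => ω) fun _ => measurable_id
  have h := indep_iSup_of_disjoint (fun v => (measurable_pi_apply v).comap_le) hind.iIndep
    (S := {[]}) (T := {[]}ᶜ) disjoint_compl_right
  rw [IndepFun_iff_Indep]
  refine indep_of_indep_of_le_left (indep_of_indep_of_le_right h ?_) ?_
  · simp only [MeasurableSpace.pi, MeasurableSpace.comap_iSup, MeasurableSpace.comap_comp]
    exact iSup_le fun i => iSup_le fun v => le_iSup₂_of_le (i :: v) (List.cons_ne_nil i v) le_rfl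
  · exact le_iSup₂_of_le [] rfl le_rfl

end Tree

/-! ### Root fields and their limits -/

section Field

variable (β B : ℝ)

/-- The field at the root of a labelled tree, computed from the vertices of depth at most `t`:
the labels are pairs (number of children, value), and a vertex of depth `t` has the field `G x`
where `x` is the value that it carries. -/
noncomputable def treeField (G : ℝ → ℝ) : ℕ → (List ℕ → ℕ∞ × ℝ) → ℝ
  | 0, ω => G (ω []).2
  | t + 1, ω => recursionStep β B (ω []).1 fun i => treeField G t (subtree i ω)

/-- If the root field is a function `F` of the labelled tree and the fields of the children are
the values of `F'` on the subtrees, then `F` has law `recursionLaw β B ρ (law of F')`. -/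
theorem map_recursionStep_subtree (ρ : Measure ℕ∞) [IsProbabilityMeasure ρ] (ν : Measure ℝ)
    [IsProbabilityMeasure ν] {μ : Measure ℝ} [IsProbabilityMeasure μ]
    {F : (List ℕ → ℕ∞ × ℝ) → ℝ} (hF : Measurable F)
    (hμ : (treeMeasure (ρ.prod ν)).map F = μ) :
    (treeMeasure (ρ.prod ν)).map
      (fun ω => recursionStep β B (ω []).1 fun i => F (subtree i ω)) = recursionLaw β B ρ μ := by
  refine map_recursionStep_eq (K := fun ω : List ℕ → ℕ∞ × ℝ => (ω []).1)
    (X := fun i ω => F (subtree i ω)) β B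
    ⟨(measurable_fst.comp (measurable_pi_apply _)).aemeasurable, ?_⟩ (fun i => ⟨?_, ?_⟩) ?_ ?_
  · have h := Measure.map_map (μ := treeMeasure (ρ.prod ν)) measurable_fst
      (measurable_pi_apply (X := fun _ : List ℕ => ℕ∞ × ℝ) [])
    rw [(hasLaw_root (ρ.prod ν)).map_eq, Measure.map_fst_prod, measure_univ, one_smul] at h
    exact h.symm
  · exact (hF.comp (measurable_subtree i)).aemeasurable
  · have h := Measure.map_map (μ := treeMeasure (ρ.prod ν)) hF (measurable_subtree i)
    rw [(hasLaw_subtree (ρ.prod ν) i).map_eq, hμ] at h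
    exact h.symm
  · exact (iIndepFun_subtree (ρ.prod ν)).comp (fun _ => F) fun _ => hF
  · exact (indepFun_root_subtree (ρ.prod ν)).comp (φ := Prod.fst)
      (ψ := fun x i => F (x i)) measurable_fst (by fun_prop)

theorem measurable_treeField {G : ℝ → ℝ} (hG : Measurable G) (t : ℕ) :
    Measurable (treeField β B G t) := by
  induction t with
  | zero =>
    have h : Measurable fun ω : List ℕ → ℕ∞ × ℝ => (ω []).2 :=
      measurable_snd.comp (measurable_pi_apply _)
    exact hG.comp h
  | succ t ih =>
    have h1 : Measurable fun ω : List ℕ → ℕ∞ × ℝ => (ω []).1 :=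
      measurable_fst.comp (measurable_pi_apply _)
    have h2 : Measurable fun (ω : List ℕ → ℕ∞ × ℝ) (i : ℕ) => treeField β B G t (subtree i ω) :=
      measurable_pi_lambda _ fun i => ih.comp (measurable_subtree i)
    have h3 := (measurable_recursionStep β B).comp (h1.prodMk h2)
    rw [show treeField β B G (t + 1) = fun ω => recursionStep β B (ω []).1
      fun i => treeField β B G t (subtree i ω) from rfl]
    exact h3

theorem map_treeField_succ {G : ℝ → ℝ} (hG : Measurable G) (ρ : Measure ℕ∞)
    [IsProbabilityMeasure ρ] (ν : Measure ℝ) [IsProbabilityMeasure ν] {μ : Measure ℝ}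
    [IsProbabilityMeasure μ] {t : ℕ} (h : (treeMeasure (ρ.prod ν)).map (treeField β B G t) = μ) :
    (treeMeasure (ρ.prod ν)).map (treeField β B G (t + 1)) = recursionLaw β B ρ μ :=
  map_recursionStep_subtree β B ρ ν (measurable_treeField β B hG t) h

variable {β B}

theorem le_treeField_const (hβ : 0 ≤ β) (hB : 0 ≤ B) (t : ℕ) (ω : List ℕ → ℕ∞ × ℝ) :
    B ≤ treeField β B (fun _ => B) t ω := by
  induction t generalizing ω with
  | zero => exact le_rfl
  | succ t ih => exact le_recursionStep B hβ _ fun i => hB.trans (ih _)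

theorem treeField_const_le_succ (hβ : 0 ≤ β) (hB : 0 ≤ B) (t : ℕ) (ω : List ℕ → ℕ∞ × ℝ) :
    treeField β B (fun _ => B) t ω ≤ treeField β B (fun _ => B) (t + 1) ω := by
  induction t generalizing ω with
  | zero => exact le_treeField_const hβ hB 1 ω
  | succ t ih => exact recursionStep_mono B hβ _ fun i => ih _

theorem monotone_treeField_const (hβ : 0 ≤ β) (hB : 0 ≤ B) (ω : List ℕ → ℕ∞ × ℝ) :
    Monotone fun t => treeField β B (fun _ => B) t ω :=
  monotone_nat_of_le_succ fun t => treeField_const_le_succ hβ hB t ω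

theorem treeField_const_le (hβ : 0 ≤ β) (t : ℕ) (ω : List ℕ → ℕ∞ × ℝ) :
    treeField β B (fun _ => B) t ω ≤ B + (ω []).1.toNat * β := by
  cases t with
  | zero => exact le_add_of_nonneg_right (by positivity)
  | succ t => exact recursionStep_le B hβ _ _

/-- The limit, as the depth grows, of the root field with boundary field `B`. -/
noncomputable def treeFieldLimit (β B : ℝ) (ω : List ℕ → ℕ∞ × ℝ) : ℝ :=
  ⨆ t, treeField β B (fun _ => B) t ω

theorem tendsto_treeField_const (hβ : 0 ≤ β) (hB : 0 ≤ B) (ω : List ℕ → ℕ∞ × ℝ) :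
    Tendsto (fun t => treeField β B (fun _ => B) t ω) atTop (𝓝 (treeFieldLimit β B ω)) :=
  tendsto_atTop_ciSup (monotone_treeField_const hβ hB ω)
    ⟨_, Set.forall_mem_range.2 fun t => treeField_const_le hβ t ω⟩

theorem measurable_treeFieldLimit (hβ : 0 ≤ β) (hB : 0 ≤ B) :
    Measurable (treeFieldLimit β B) :=
  measurable_of_tendsto_metrizable (measurable_treeField β B measurable_const)
    (tendsto_pi_nhds.2 (tendsto_treeField_const hβ hB))

theorem treeFieldLimit_nonneg (hβ : 0 ≤ β) (hB : 0 ≤ B) (ω : List ℕ → ℕ∞ × ℝ) :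
    0 ≤ treeFieldLimit β B ω :=
  hB.trans (ge_of_tendsto' (tendsto_treeField_const hβ hB ω) fun t => le_treeField_const hβ hB t ω)

theorem treeFieldLimit_eq (hβ : 0 ≤ β) (hB : 0 ≤ B) (ω : List ℕ → ℕ∞ × ℝ) :
    treeFieldLimit β B ω =
      recursionStep β B (ω []).1 fun i => treeFieldLimit β B (subtree i ω) :=
  tendsto_nhds_unique ((tendsto_add_atTop_iff_nat 1).2 (tendsto_treeField_const hβ hB ω))
    (tendsto_recursionStep β B _ fun i => tendsto_treeField_const hβ hB (subtree i ω))

/-- The depth shifts by one because one step from a nonnegative boundary already yields a field of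
at least `B`. -/
theorem treeField_const_le_treeField {G : ℝ → ℝ} (hG : ∀ x, 0 ≤ G x) (hβ : 0 ≤ β)
    (t : ℕ) (ω : List ℕ → ℕ∞ × ℝ) :
    treeField β B (fun _ => B) t ω ≤ treeField β B G (t + 1) ω := by
  induction t generalizing ω with
  | zero => exact le_recursionStep B hβ _ fun i => hG _
  | succ t ih => exact recursionStep_mono B hβ _ fun i => ih _

/-- The influence of a nonnegative boundary condition is controlled by one step of the recursion
with boundary field `B`. -/
theorem treeField_sub_le {G : ℝ → ℝ} (hG : ∀ x, 0 ≤ G x) (hβ : 0 ≤ β) (hB : 0 ≤ B) {M : ℝ}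
    (hM : 1 ≤ M) (hMβ : β ≤ M * message β B) (t : ℕ) (ω : List ℕ → ℕ∞ × ℝ) :
    treeField β B G (t + 2) ω - treeField β B (fun _ => B) t ω
      ≤ M * (treeField β B (fun _ => B) (t + 1) ω - treeField β B (fun _ => B) t ω) := by
  induction t generalizing ω with
  | zero =>
    -- Each message is at most `β`, while with boundary `B` it is exactly `message β B`; `M`
    -- compares the two.
    have h1 : treeField β B G 2 ω ≤ B + (ω []).1.toNat * β := recursionStep_le B hβ _ _
    have h2 : treeField β B (fun _ => B) 1 ω = B + (ω []).1.toNat * message β B := by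
      simp [treeField, recursionStep_eq]
    have h3 : treeField β B (fun _ => B) 0 ω = B := rfl
    have h4 := mul_le_mul_of_nonneg_left hMβ (Nat.cast_nonneg (α := ℝ) (ω []).1.toNat)
    rw [zero_add, zero_add, h2, h3]
    linarith
  | succ t ih =>
    exact recursionStep_sub_le B hβ hM _ (fun i => hB.trans (le_treeField_const hβ hB t _))
      (fun i => treeField_const_le_succ hβ hB t _)
      (fun i => treeField_const_le_treeField hG hβ (t + 1) _) fun i => ih _

/-- Every nonnegative boundary condition leads to the same limit. -/
theorem tendsto_treeField {G : ℝ → ℝ} (hG : ∀ x, 0 ≤ G x) (hβ : 0 ≤ β) (hB : 0 < B)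
    (ω : List ℕ → ℕ∞ × ℝ) :
    Tendsto (fun t => treeField β B G t ω) atTop (𝓝 (treeFieldLimit β B ω)) := by
  obtain ⟨M, hM, hMβ⟩ := exists_le_mul_message hβ hB
  have h0 := tendsto_treeField_const hβ hB.le ω
  have h1 := (tendsto_add_atTop_iff_nat 1).2 h0
  refine (tendsto_add_atTop_iff_nat 2).1 (tendsto_of_tendsto_of_tendsto_of_le_of_le h1
    (h := fun t => treeField β B (fun _ => B) t ω +
      M * (treeField β B (fun _ => B) (t + 1) ω - treeField β B (fun _ => B) t ω)) ?_ ?_ ?_)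
  · simpa using h0.add ((h1.sub h0).const_mul M)
  · exact fun t => treeField_const_le_treeField hG hβ (t + 1) ω
  · intro t
    have := treeField_sub_le hG hβ hB.le hM hMβ t ω
    simp only
    linarith

/-- The law of the limiting root field is a fixed point of the recursion. -/
theorem map_treeFieldLimit (hβ : 0 ≤ β) (hB : 0 ≤ B) (ρ : Measure ℕ∞) [IsProbabilityMeasure ρ]
    (ν : Measure ℝ) [IsProbabilityMeasure ν] {μ : Measure ℝ} [IsProbabilityMeasure μ]
    (h : (treeMeasure (ρ.prod ν)).map (treeFieldLimit β B) = μ) :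
    recursionLaw β B ρ μ = μ := by
  rw [← map_recursionStep_subtree β B ρ ν (measurable_treeFieldLimit hβ hB) h]
  simp_rw [← treeFieldLimit_eq hβ hB]
  exact h

/-- Started from a nonnegative fixed point, the tree recursion has a constant law. -/
theorem map_treeField_abs {ρ : Measure ℕ∞} [IsProbabilityMeasure ρ] {ν : ProbabilityMeasure ℝ}
    (hν : IsNonnegFixedPoint β B ρ ν) (t : ℕ) :
    (treeMeasure (ρ.prod (ν : Measure ℝ))).map (treeField β B (fun x => |x|) t) = ν := by
  induction t with
  | zero =>
    have h1 := Measure.map_map (μ := treeMeasure (ρ.prod (ν : Measure ℝ)))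
      (measurable_snd (α := ℕ∞) (β := ℝ))
      (measurable_pi_apply (X := fun _ : List ℕ => ℕ∞ × ℝ) [])
    rw [(hasLaw_root _).map_eq, Measure.map_snd_prod, measure_univ, one_smul] at h1
    have h2 := Measure.map_map (μ := treeMeasure (ρ.prod (ν : Measure ℝ)))
      (measurable_id (α := ℝ)).abs
      (measurable_snd.comp (measurable_pi_apply (X := fun _ : List ℕ => ℕ∞ × ℝ) []))
    rw [← h1] at h2
    -- `|x| = x` almost everywhere for `ν`; the absolute value only makes the boundary nonnegative
    -- at every point.
    refine h2.symm.trans ((Measure.map_congr ?_).trans Measure.map_id)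
    have h3 : ∀ᵐ x ∂(ν : Measure ℝ), x ∉ Set.Iio 0 := measure_eq_zero_iff_ae_notMem.1 hν.2
    filter_upwards [h3] with x hx
    exact abs_of_nonneg (not_lt.1 hx)
  | succ t ih => exact (map_treeField_succ β B (by fun_prop) ρ ν ih).trans hν.1

theorem tendstoInDistribution_treeField {G : ℝ → ℝ} (hG : ∀ x, 0 ≤ G x) (hGm : Measurable G)
    (hβ : 0 ≤ β) (hB : 0 < B) (ρ : Measure ℕ∞) [IsProbabilityMeasure ρ]
    (ν : Measure ℝ) [IsProbabilityMeasure ν] :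
    TendstoInDistribution (treeField β B G) atTop (treeFieldLimit β B)
      (fun _ => treeMeasure (ρ.prod ν)) (treeMeasure (ρ.prod ν)) :=
  tendstoInDistribution_of_ae_tendsto
    (fun t => (measurable_treeField β B hGm t).aemeasurable)
    (measurable_treeFieldLimit hβ hB.le).aemeasurable
    (ae_of_all _ (tendsto_treeField hG hβ hB))

/-- A nonnegative fixed point is the law of the limiting root field. -/
theorem map_treeFieldLimit_of_isNonnegFixedPoint (hβ : 0 ≤ β) (hB : 0 < B) {ρ : Measure ℕ∞}
    [IsProbabilityMeasure ρ] {ν : ProbabilityMeasure ℝ} (hν : IsNonnegFixedPoint β B ρ ν) :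
    (treeMeasure (ρ.prod (ν : Measure ℝ))).map (treeFieldLimit β B) = ν := by
  have h1 := tendstoInDistribution_treeField (G := fun x => |x|) abs_nonneg (by fun_prop)
    hβ hB ρ (ν : Measure ℝ)
  have h2 : TendstoInDistribution (treeField β B fun x => |x|) atTop (id : ℝ → ℝ)
      (fun _ => treeMeasure (ρ.prod (ν : Measure ℝ))) (ν : Measure ℝ) :=
    tendstoInDistribution_of_identDistrib 0
      (fun t => ⟨h1.forall_aemeasurable 0, h1.forall_aemeasurable t,
        by rw [map_treeField_abs hν, map_treeField_abs hν]⟩)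
      ⟨h1.forall_aemeasurable 0, aemeasurable_id, by rw [map_treeField_abs hν, Measure.map_id]⟩
  rw [tendstoInDistribution_unique _ h1 h2, Measure.map_id]

end Field

/-! ### Transfer to the given sequence -/

/-- The law at time `t` determines the one at `t + 1`, so no joint law across times matters. The
value law `ν` is free, since the constant boundary ignores it. -/
theorem map_eq_map_treeField {β B : ℝ} {Ω : Type*} [MeasurableSpace Ω] {P : Measure Ω}
    [IsProbabilityMeasure P] {ρ : Measure ℕ∞} [IsProbabilityMeasure ρ]
    {K : ℕ → Ω → ℕ∞} (hK : ∀ t, HasLaw (K t) ρ P)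
    {h : ℕ → Ω → ℝ} {X : ℕ → ℕ → Ω → ℝ} (h_zero : h 0 =ᵐ[P] fun _ => B)
    (hX : ∀ t i, IdentDistrib (X t i) (h t) P P) (hXindep : ∀ t, iIndepFun (X t) P)
    (hKX : ∀ t, IndepFun (K t) (fun ω i => X t i ω) P)
    (h_succ : ∀ t, IdentDistrib (h (t + 1))
      (fun ω => recursionStep β B (K t ω) (fun i => X t i ω)) P P)
    (ν : Measure ℝ) [IsProbabilityMeasure ν] (t : ℕ) :
    (treeMeasure (ρ.prod ν)).map (treeField β B (fun _ => B) t) = P.map (h t) := by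
  induction t with
  | zero =>
    rw [Measure.map_congr h_zero, Measure.map_const, measure_univ]
    change (treeMeasure (ρ.prod ν)).map (fun _ => B) = _
    rw [Measure.map_const, measure_univ]
  | succ t ih =>
    have hm : IsProbabilityMeasure (P.map (h t)) :=
      Measure.isProbabilityMeasure_map (hX t 0).aemeasurable_snd
    rw [map_treeField_succ β B measurable_const ρ ν ih, (h_succ t).map_eq]
    exact (map_recursionStep_eq β B (hK t)
      (fun i => ⟨(hX t i).aemeasurable_fst, (hX t i).map_eq⟩) (hXindep t) (hKX t)).symm

theorem mainTheorem4 (β B : ℝ) (hβ : 0 ≤ β) (hB : 0 < B)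
    {Ω : Type*} [MeasurableSpace Ω] (P : Measure Ω) [IsProbabilityMeasure P]
    (ρ : Measure ℕ∞) [IsProbabilityMeasure ρ]
    (K : ℕ → Ω → ℕ∞) (hK : ∀ t, HasLaw (K t) ρ P) (hKindep : iIndepFun K P)
    (hKfin : ∀ᵐ ω ∂P, K 0 ω < ⊤)
    (h : ℕ → Ω → ℝ) (X : ℕ → ℕ → Ω → ℝ)
    (h_zero : h 0 =ᵐ[P] fun _ => B)
    (hX : ∀ t i, IdentDistrib (X t i) (h t) P P)
    (hXindep : ∀ t, iIndepFun (X t) P)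
    (hKX : ∀ t, IndepFun (K t) (fun ω i => X t i ω) P)
    (h_succ : ∀ t, IdentDistrib (h (t + 1))
      (fun ω => recursionStep β B (K t ω) (fun i => X t i ω)) P P) :
    (∀ s t : ℕ, s ≤ t → StochLE (P.map (h s)) (P.map (h t))) ∧
    ∃ ν : ProbabilityMeasure ℝ,
      IsNonnegFixedPoint β B ρ ν ∧
      (∀ ν' : ProbabilityMeasure ℝ, IsNonnegFixedPoint β B ρ ν' → ν' = ν) ∧
      TendstoInDistribution h atTop (id : ℝ → ℝ) (fun _ => P) (ν : Measure ℝ) := by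
  have hlaw := fun (ν : Measure ℝ) (_ : IsProbabilityMeasure ν) (t : ℕ) =>
    map_eq_map_treeField hK h_zero hX hXindep hKX h_succ ν t
  have hmeas : ∀ t, Measurable (treeField β B (fun _ => B) t) :=
    measurable_treeField β B measurable_const
  have hlim := measurable_treeFieldLimit hβ hB.le
  have hconv : ∀ (ν : Measure ℝ) [IsProbabilityMeasure ν],
      TendstoInDistribution h atTop (treeFieldLimit β B) (fun _ => P)
        (treeMeasure (ρ.prod ν)) := by
    intro ν _
    refine ⟨fun t => (hX t 0).aemeasurable_snd, hlim.aemeasurable, ?_⟩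
    have := (tendstoInDistribution_treeField (G := fun _ => B) (fun _ => hB.le) measurable_const
      hβ hB ρ ν).tendsto
    simpa only [hlaw ν inferInstance] using this
  refine ⟨fun s t hst x => ?_, ?_⟩
  · rw [← hlaw (Measure.dirac 0) inferInstance, ← hlaw (Measure.dirac 0) inferInstance,
      Measure.map_apply (hmeas s) measurableSet_Ioi, Measure.map_apply (hmeas t) measurableSet_Ioi]
    exact measure_mono fun ω hω => lt_of_lt_of_le hω (monotone_treeField_const hβ hB.le ω hst)
  · obtain ⟨ν, hν⟩ : ∃ ν : ProbabilityMeasure ℝ,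
        (treeMeasure (ρ.prod (Measure.dirac (0 : ℝ)))).map (treeFieldLimit β B) = ν :=
      ⟨⟨_, Measure.isProbabilityMeasure_map hlim.aemeasurable⟩, rfl⟩
    refine ⟨ν, ⟨map_treeFieldLimit hβ hB.le ρ _ hν, ?_⟩, fun ν' hν' => ?_, ?_⟩
    · rw [← hν, Measure.map_apply hlim measurableSet_Iio]
      refine measure_mono_null (fun ω hω => ?_) measure_empty
      exact absurd hω (not_lt.2 (treeFieldLimit_nonneg hβ hB.le ω))
    · refine Subtype.ext ((map_treeFieldLimit_of_isNonnegFixedPoint hβ hB hν').symm.trans ?_)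
      -- The limits built over `ν'` and over the Dirac mass are both limits in distribution of `h`,
      -- so their laws agree.
      exact (tendstoInDistribution_unique h (hconv ν') (hconv (Measure.dirac 0))).trans hν
    · refine ⟨fun t => (hX t 0).aemeasurable_snd, aemeasurable_id, ?_⟩
      simpa only [hν, Measure.map_id] using (hconv (Measure.dirac 0)).tendsto
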